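/- Let $d\ge 2$, $\lambda_0>0$ and $\Lambda\in\mathbb R$. There are constants $C_1,C_2>0$, depending only on $d,\lambda_0,\Lambda$, such that the following holds. Let $\Omega\subset\mathbb R^d$ be a bounded open set, and let $\mathbb C=(\mathbb C_{ijkl})\in L^\infty(\Omega)$ be a fourth-order tensor field with $|\mathbb C_{ijkl}|\le\Lambda$ a.e. in $\Omega$ which is strongly convex: for a.e. $x\in\Omega$, $\mathbb C(x)A:A\ge\lambda_0|A|^2$ for every symmetric $d\times d$ matrix $A$, where $(\mathbb CA)_{ij}=\sum_{k,l}\mathbb C_{ijkl}A_{kl}$, $A:B=\sum_{i,j}A_{ij}B_{ij}$ and $|A|^2=A:A$. Let $f\in H^{-1}(\Omega;\mathbb R^d)$, and let $u\in H^1(\Omega;\mathbb R^d)$ be a weak solution of $\operatorname{div}(\mathbb C\widehat\nabla u)=f$ in $\Omega$, that is, $$\int_\Omega \mathbb C\widehat\nabla u:\widehat\nabla\varphi\,dx=-\langle f,\varphi\rangle\qquad\text{for all }\varphi\in C_c^\infty(\Omega;\mathbb R^d),$$ where $\widehat\nabla u=\tfrac12(\nabla u+(\nabla u)^T)$. Then,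 for all concentric open balls $B_\rho$ and $B_{2\rho}$ of radii $\rho>0$ and $2\rho$ with $B_{2\rho}\subset\Omega$, and every constant vector $\bar u\in\mathbb R^d$, $$\|\nabla u\|^2_{L^2(B_\rho)}\le\frac{C_1}{\rho^2}\|u-\bar u\|^2_{L^2(B_{2\rho})}+C_2\|f\|^2_{H^{-1}(B_{2\rho})}.$$ Here, for a bounded open set $U$, $H^{-1}(U;\mathbb R^d)$ is the dual of $H^1_0(U;\mathbb R^d)$ normed by $\|\nabla\varphi\|_{L^2(U)}$, so that $\|f\|_{H^{-1}(U)}$ is the smallest $K\ge0$ with $|\langle f,\varphi\rangle|\le K\|\nabla\varphi\|_{L^2(U)}$ for all $\varphi\in C_c^\infty(U;\mathbb R^d)$. -/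

import Mathlib

open MeasureTheory TopologicalSpace
open scoped Distributions

noncomputable section

namespace Elasticity

/-- The Euclidean space `ℝ^d`. -/
abbrev Vec (d : ℕ) : Type := EuclideanSpace ℝ (Fin d)

/-- Real `d × d` matrices. -/
abbrev Mat (d : ℕ) : Type := Matrix (Fin d) (Fin d) ℝ

/-- Fourth order tensors, given by their entries `ℂ_{ijkl}`. -/
abbrev Tensor4 (d : ℕ) : Type := Fin d → Fin d → Fin d → Fin d → ℝ

/-- The `j`-th vector of the standard basis of `ℝ^d`. -/
abbrev basisVec {d : ℕ} (j : Fin d) : Vec d := EuclideanSpace.single j (1 : ℝ)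

/-- The scalar product `A : B = ∑_{ij} A_{ij} B_{ij}`. -/
def dot {d : ℕ} (A B : Mat d) : ℝ := ∑ i, ∑ j, A i j * B i j

/-- The square `|A|² = ∑_{ij} A_{ij}²` of the Frobenius norm. -/
def normSq {d : ℕ} (A : Mat d) : ℝ := ∑ i, ∑ j, A i j ^ 2

/-- The symmetrization `(A + Aᵀ)/2`. -/
def symPart {d : ℕ} (A : Mat d) : Mat d := (2⁻¹ : ℝ) • (A + A.transpose)

/-- The matrix `(ℂA)_{ij} = ∑_{kl} ℂ_{ijkl} A_{kl}`. -/
def Tensor4.app {d : ℕ} (C : Tensor4 d) (A : Mat d) : Mat d :=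
  Matrix.of fun i j => ∑ k, ∑ l, C i j k l * A k l

/-- The classical gradient `(∇φ)_{ij} = ∂_j φ_i` of a differentiable vector field. -/
def grad {d : ℕ} (φ : Vec d → Vec d) (x : Vec d) : Mat d :=
  Matrix.of fun i j => fderiv ℝ φ x (basisVec j) i

/-- `u ∈ H¹(Ω; ℝ^d)` with weak gradient `G`, `G_{ij} = ∂_j u_i`: all components of `u` and `G` are
in `L²(Ω)`, and `∫_Ω u_i ∂_j η = - ∫_Ω G_{ij} η` for all `η ∈ C_c^∞(Ω)`. -/
structure IsH1 {d : ℕ} (Ω : Opens (Vec d)) (u : Vec d → Vec d) (G : Vec d → Mat d) : Prop where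
  memLp : ∀ i, MemLp (fun x => u x i) 2 (volume.restrict (Ω : Set (Vec d)))
  memLp_grad : ∀ i j, MemLp (fun x => G x i j) 2 (volume.restrict (Ω : Set (Vec d)))
  weak_grad : ∀ i j, ∀ η : 𝓓(Ω, ℝ),
    ∫ x in (Ω : Set (Vec d)), u x i * fderiv ℝ η x (basisVec j) =
      - ∫ x in (Ω : Set (Vec d)), G x i j * η x

/-- `ℂ ∈ L^∞(Ω)`, with all entries bounded by `Λ` almost everywhere. -/
structure IsBoundedTensor {d : ℕ} (Ω : Opens (Vec d)) (C : Vec d → Tensor4 d) (Λ : ℝ) : Prop where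
  meas : ∀ i j k l,
    AEStronglyMeasurable (fun x => C x i j k l) (volume.restrict (Ω : Set (Vec d)))
  bound : ∀ i j k l, ∀ᵐ x ∂(volume.restrict (Ω : Set (Vec d))), |C x i j k l| ≤ Λ

/-- Strong convexity with constant `lam`: for almost every `x ∈ Ω`, `ℂ(x)A : A ≥ lam |A|²` for every
symmetric matrix `A`. -/
def IsStronglyConvex {d : ℕ} (Ω : Opens (Vec d)) (C : Vec d → Tensor4 d) (lam : ℝ) : Prop :=
  ∀ᵐ x ∂(volume.restrict (Ω : Set (Vec d))),
    ∀ A : Mat d, A.IsSymm → lam * normSq A ≤ dot ((C x).app A) A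

/-- The norm `‖∇φ‖_{L²}` of a test field. -/
def gradNorm {d : ℕ} {Ω : Opens (Vec d)} (φ : 𝓓(Ω, Vec d)) : ℝ :=
  Real.sqrt (∫ x, normSq (grad φ x))

/-- `K` bounds `f` on the fields supported in `U`: `|⟨f, φ⟩| ≤ K ‖∇φ‖_{L²}` for every test field `φ`
with support in `U`. -/
def IsHNegOneBound {d : ℕ} {Ω : Opens (Vec d)} (f : 𝓓(Ω, Vec d) →ₗ[ℝ] ℝ) (U : Set (Vec d))
    (K : ℝ) : Prop :=
  0 ≤ K ∧ ∀ φ : 𝓓(Ω, Vec d), tsupport φ ⊆ U → |f φ| ≤ K * gradNorm φ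

/-- `f ∈ H^{-1}(Ω; ℝ^d)` for a bounded open set `Ω`: `f` is bounded for the norm `‖∇φ‖_{L²}` on
`C_c^∞(Ω; ℝ^d)`, which is dense in `H^1_0(Ω; ℝ^d)`. -/
def IsHNegOne {d : ℕ} {Ω : Opens (Vec d)} (f : 𝓓(Ω, Vec d) →ₗ[ℝ] ℝ) : Prop :=
  ∃ K, IsHNegOneBound f (Ω : Set (Vec d)) K

/-- The norm `‖f‖_{H^{-1}(U)}` of the restriction of `f` to an open set `U ⊆ Ω`, dual to the norm
`‖∇φ‖_{L²(U)}` of `H^1_0(U; ℝ^d)`: the smallest bound of `f` on the fields supported in `U`. -/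
def hNegOneNorm {d : ℕ} {Ω : Opens (Vec d)} (f : 𝓓(Ω, Vec d) →ₗ[ℝ] ℝ) (U : Set (Vec d)) : ℝ :=
  sInf {K | IsHNegOneBound f U K}

/-- The field with weak gradient `G` is a weak solution of `div(ℂ sym(G)) = f` in `Ω`:
`∫_Ω ℂ sym(G) : sym(∇φ) = - ⟨f, φ⟩` for every `φ ∈ C_c^∞(Ω; ℝ^d)`. -/
def IsWeakSolution {d : ℕ} (Ω : Opens (Vec d)) (C : Vec d → Tensor4 d) (G : Vec d → Mat d)
    (f : 𝓓(Ω, Vec d) →ₗ[ℝ] ℝ) : Prop :=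
  ∀ φ : 𝓓(Ω, Vec d),
    ∫ x in (Ω : Set (Vec d)), dot ((C x).app (symPart (G x))) (symPart (grad φ x)) = - f φ

end Elasticity

end

/-! This is a Caccioppoli inequality: the equation is tested with η²v, where v = u − ū and η is a
cutoff equal to 1 on the small ball and supported in the large one. Write e for the symmetrized
gradient of u, and T = v ⊗ ∇η. The tested integrand is ℂ(ηe) : ηe + 2 ℂ(ηe) : sym T. Strong
convexity bounds the first term from below, and Young's inequality absorbs the second at the price
of a multiple of |T|² (`coercive_pointwise`). The right-hand side is at most ‖f‖ ‖∇(η²v)‖.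

Coercivity controls only e, while both ‖∇(η²v)‖ and the conclusion involve full gradients. Korn's
inequality for compactly supported fields closes this gap: two integrations by parts turn ∫ ∇φ :
(∇φ)ᵀ into ∫ (div φ)² ≥ 0, hence ‖∇φ‖² ≤ 2 ‖sym ∇φ‖² (`korn_testField`). Applied to ηv it serves
both purposes, and the terms are balanced in `cutoff_estimate`. Finally |∇η|² ≤ c/ρ² bounds ‖T‖² by
the L² norm of u − ū.

The equation, the bound on f and Korn's inequality are first available for smooth test fields only,
whereas ηv and η²v are merely H¹. Mollification extends them to H¹ fields with compact support
(`IsH1CompactIn.exists_testField_tendsto`). -/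

open scoped Convolution ENNReal

/-! ### Mollification in L². -/

namespace MeasureTheory

section Mollification

variable {E : Type*} [NormedAddCommGroup E] [MeasurableSpace E] [BorelSpace E]
  {μ : Measure E}

/-- Translations form a continuous family of measure preserving maps, and composition with such a
family is continuous into L². -/
theorem MemLp.tendsto_eLpNorm_translate_sub [NormedSpace ℝ E] [FiniteDimensional ℝ E]
    [μ.IsAddHaarMeasure] {g : E → ℝ} (hg : MemLp g 2 μ) :
    Filter.Tendsto (fun t => eLpNorm (fun x => g (x - t) - g x) 2 μ) (nhds 0) (nhds 0) := by
  have : ProperSpace E := FiniteDimensional.proper ℝ E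
  let F : C(E, C(E, E)) := ContinuousMap.curry ⟨fun p : E × E => p.2 - p.1, by fun_prop⟩
  have hF : ∀ t, MeasurePreserving (F t) μ μ := fun t => measurePreserving_sub_right μ t
  have hc : Continuous fun t => Lp.compMeasurePreserving (F t) (hF t) (hg.toLp g) :=
    continuous_const.compMeasurePreservingLp F.continuous hF (by simp)
  have h0 := hc.tendsto 0
  have h1 : Lp.compMeasurePreserving (F 0) (hF 0) (hg.toLp g) = hg.toLp g := by
    rw [Lp.toLp_compMeasurePreserving]
    congr 1
    ext x
    simp [F]
  rw [h1] at h0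
  simp only [Lp.toLp_compMeasurePreserving] at h0
  rw [Lp.tendsto_Lp_iff_tendsto_eLpNorm''] at h0
  exact h0

theorem lintegral_rpow_two_le {α : Type*} [MeasurableSpace α] {ν : Measure α}
    [IsProbabilityMeasure ν] {a : α → ℝ≥0∞} (ha : AEMeasurable a ν) :
    (∫⁻ t, a t ∂ν) ^ (2 : ℝ) ≤ ∫⁻ t, a t ^ (2 : ℝ) ∂ν := by
  have h := ENNReal.lintegral_mul_le_Lp_mul_Lq ν Real.HolderConjugate.two_two ha
    (aemeasurable_const (b := (1 : ℝ≥0∞)))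
  simp only [Pi.mul_apply, mul_one, ENNReal.one_rpow, lintegral_const, measure_univ] at h
  calc (∫⁻ t, a t ∂ν) ^ (2 : ℝ) ≤ ((∫⁻ t, a t ^ (2 : ℝ) ∂ν) ^ (1 / (2 : ℝ))) ^ (2 : ℝ) :=
        ENNReal.rpow_le_rpow h (by norm_num)
    _ = _ := by rw [← ENNReal.rpow_mul]; norm_num

theorem eLpNorm_two_rpow {α : Type*} [MeasurableSpace α] {ν : Measure α} (f : α → ℝ) :
    eLpNorm f 2 ν ^ (2 : ℝ) = ∫⁻ x, ‖f x‖ₑ ^ (2 : ℝ) ∂ν := by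
  rw [eLpNorm_eq_lintegral_rpow_enorm_toReal (by norm_num) (by norm_num), ← ENNReal.rpow_mul]
  norm_num

/-- With ψ as a probability density, g ⋆ ψ − g is the ψ-average of the differences g(· − t) − g.
Jensen's inequality for the square and Tonelli's theorem bound its L² norm by that of the worst
difference. -/
theorem eLpNorm_convolution_sub_le [NormedSpace ℝ E] [FiniteDimensional ℝ E]
    [μ.IsAddHaarMeasure] {g ψ : E → ℝ} (hg : MemLp g 2 μ)
    (hψc : Continuous ψ) (hψs : HasCompactSupport ψ) (hψ0 : ∀ x, 0 ≤ ψ x) (hψ1 : ∫ x, ψ x ∂μ = 1)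
    {ε : ℝ≥0∞}
    (hε : ∀ t ∈ Function.support ψ, eLpNorm (fun x => g (x - t) - g x) 2 μ ≤ ε) :
    eLpNorm (g ⋆[ContinuousLinearMap.mul ℝ ℝ, μ] ψ - g) 2 μ ≤ ε := by
  have : ProperSpace E := FiniteDimensional.proper ℝ E
  have hψi : Integrable ψ μ := hψc.integrable_of_hasCompactSupport hψs
  have hψm : Measurable fun t => ENNReal.ofReal (ψ t) := hψc.measurable.ennreal_ofReal
  set ν : Measure E := μ.withDensity fun t => ENNReal.ofReal (ψ t) with hν
  have hprob : IsProbabilityMeasure ν := by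
    constructor
    rw [hν, withDensity_apply _ MeasurableSet.univ, Measure.restrict_univ,
      ← ofReal_integral_eq_lintegral_ofReal hψi (.of_forall hψ0), hψ1, ENNReal.ofReal_one]
  have hac : ν ≪ μ := withDensity_absolutelyContinuous _ _
  have hgl : LocallyIntegrable g μ := hg.locallyIntegrable (by norm_num)
  have hm : AEMeasurable (fun p : E × E => ‖g (p.1 - p.2) - g p.1‖ₑ) (μ.prod ν) := by
    have h1 : AEStronglyMeasurable (fun p : E × E => g (p.1 - p.2)) (μ.prod μ) :=
      hg.1.comp_quasiMeasurePreserving (quasiMeasurePreserving_sub μ μ)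
    have h2 : AEStronglyMeasurable (fun p : E × E => g p.1) (μ.prod μ) := hg.1.comp_fst
    -- Measurability is proved for μ × μ, where subtraction is quasi measure preserving, and passes
    -- to μ × ν because ν ≪ μ.
    exact ((h1.sub h2).enorm).mono_ac (Measure.AbsolutelyContinuous.rfl.prod hac)
  have hpt : ∀ᵐ x ∂μ, ‖(g ⋆[ContinuousLinearMap.mul ℝ ℝ, μ] ψ - g) x‖ₑ ^ (2 : ℝ) ≤
      ∫⁻ t, ‖g (x - t) - g x‖ₑ ^ (2 : ℝ) ∂ν := by
    filter_upwards [hm.aestronglyMeasurable.prodMk_left] with x hx'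
    have hx : AEMeasurable (fun t => ‖g (x - t) - g x‖ₑ) ν := hx'.aemeasurable
    refine le_trans (ENNReal.rpow_le_rpow ?_ (by norm_num)) (lintegral_rpow_two_le hx)
    have hex := (hψs.convolutionExists_right (ContinuousLinearMap.mul ℝ ℝ) hgl hψc x).integrable_swap
    simp only [ContinuousLinearMap.mul_apply'] at hex
    have heq : (g ⋆[ContinuousLinearMap.mul ℝ ℝ, μ] ψ - g) x =
        ∫ t, (g (x - t) - g x) * ψ t ∂μ := by
      simp only [Pi.sub_apply, sub_mul]
      rw [integral_sub hex (hψi.const_mul _), integral_const_mul, hψ1, mul_one,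
        convolution_eq_swap]
      rfl
    rw [heq, hν, lintegral_withDensity_eq_lintegral_mul₀' hψm.aemeasurable hx]
    refine (enorm_integral_le_lintegral_enorm _).trans (le_of_eq (lintegral_congr fun t => ?_))
    rw [enorm_mul, mul_comm, Pi.mul_apply, Real.enorm_of_nonneg (hψ0 t)]
  have hmain : eLpNorm (g ⋆[ContinuousLinearMap.mul ℝ ℝ, μ] ψ - g) 2 μ ^ (2 : ℝ) ≤
      ε ^ (2 : ℝ) := by
    rw [eLpNorm_two_rpow]
    refine (lintegral_mono_ae hpt).trans ?_
    rw [lintegral_lintegral_swap (hm.pow_const 2)]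
    have hae : ∀ᵐ t ∂ν, ∫⁻ x, ‖g (x - t) - g x‖ₑ ^ (2 : ℝ) ∂μ ≤ ε ^ (2 : ℝ) := by
      rw [hν, ae_withDensity_iff hψm]
      refine .of_forall fun t ht => ?_
      rw [← eLpNorm_two_rpow]
      refine ENNReal.rpow_le_rpow (hε t fun h => ht (by simp [h])) (by norm_num)
    refine (lintegral_mono_ae hae).trans ?_
    simp
  exact (ENNReal.rpow_le_rpow_iff (by norm_num)).1 hmain

theorem tendsto_eLpNorm_convolution_sub [NormedSpace ℝ E] [FiniteDimensional ℝ E]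
    [μ.IsAddHaarMeasure] {ι : Type*} {l : Filter ι} {g : E → ℝ} (hg : MemLp g 2 μ)
    {φ : ι → ContDiffBump (0 : E)} (hφ : Filter.Tendsto (fun n => (φ n).rOut) l (nhds 0)) :
    Filter.Tendsto
      (fun n => eLpNorm (g ⋆[ContinuousLinearMap.mul ℝ ℝ, μ] (φ n).normed μ - g) 2 μ)
      l (nhds 0) := by
  rw [ENNReal.tendsto_nhds_zero]
  intro ε hε
  obtain ⟨δ, hδ, hball⟩ := Metric.eventually_nhds_iff.1
    (ENNReal.tendsto_nhds_zero.1 hg.tendsto_eLpNorm_translate_sub ε hε)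
  filter_upwards [(tendsto_order.1 hφ).2 δ hδ] with n hn
  refine eLpNorm_convolution_sub_le hg (φ n).continuous_normed (φ n).hasCompactSupport_normed
    (φ n).nonneg_normed (φ n).integral_normed fun t ht => hball ?_
  rw [(φ n).support_normed_eq] at ht
  exact (Metric.mem_ball.1 ht).trans hn

end Mollification

/-- Continuity of the L² inner product. -/
theorem tendsto_integral_mul_of_tendsto_eLpNorm {α ι : Type*} [MeasurableSpace α] {μ : Measure α}
    {l : Filter ι} {a b : ι → α → ℝ} {a' b' : α → ℝ}
    (ha : ∀ n, MemLp (a n) 2 μ) (hb : ∀ n, MemLp (b n) 2 μ) (ha' : MemLp a' 2 μ)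
    (hb' : MemLp b' 2 μ) (hat : Filter.Tendsto (fun n => eLpNorm (a n - a') 2 μ) l (nhds 0))
    (hbt : Filter.Tendsto (fun n => eLpNorm (b n - b') 2 μ) l (nhds 0)) :
    Filter.Tendsto (fun n => ∫ x, a n x * b n x ∂μ) l (nhds (∫ x, a' x * b' x ∂μ)) := by
  have key : ∀ {f g : α → ℝ} (hf : MemLp f 2 μ) (hg : MemLp g 2 μ),
      ∫ x, f x * g x ∂μ = inner ℝ (hg.toLp g) (hf.toLp f) := by
    intro f g hf hg
    rw [L2.inner_def]
    refine integral_congr_ae ?_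
    filter_upwards [hf.coeFn_toLp, hg.coeFn_toLp] with x h1 h2
    rw [h1, h2]
    simp
  rw [key ha' hb']
  simp_rw [fun n => key (ha n) (hb n)]
  exact ((Lp.tendsto_Lp_iff_tendsto_eLpNorm'' _ hb _ hb').2 hbt).inner
    ((Lp.tendsto_Lp_iff_tendsto_eLpNorm'' _ ha _ ha').2 hat)

end MeasureTheory

/-! ### Integration by parts and weak derivatives of convolutions. -/

section Calculus

variable {E : Type*} [NormedAddCommGroup E] [NormedSpace ℝ E]

theorem HasCompactSupport.fderiv_dir {f : E → ℝ} (hf : HasCompactSupport f) (v : E) :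
    HasCompactSupport fun x => fderiv ℝ f x v :=
  (hf.fderiv ℝ).comp_left (g := fun L : E →L[ℝ] ℝ => L v) rfl

theorem ContDiff.fderiv_dir {f : E → ℝ} (hf : ContDiff ℝ (⊤ : ℕ∞) f) (v : E) :
    ContDiff ℝ (⊤ : ℕ∞) fun x => fderiv ℝ f x v :=
  (hf.fderiv_right (m := (⊤ : ℕ∞)) (by norm_cast)).clm_apply contDiff_const

variable [FiniteDimensional ℝ E] [MeasurableSpace E] [BorelSpace E] {μ : Measure E}
  [μ.IsAddHaarMeasure]

theorem integral_mul_fderiv_eq_neg_of_hasCompactSupport {f g : E → ℝ}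
    (hf : ContDiff ℝ (⊤ : ℕ∞) f) (hg : ContDiff ℝ (⊤ : ℕ∞) g) (hfs : HasCompactSupport f) (v : E) :
    ∫ x, f x * fderiv ℝ g x v ∂μ = - ∫ x, fderiv ℝ f x v * g x ∂μ := by
  have h1 := (hf.fderiv_dir v).continuous
  have h2 := (hg.fderiv_dir v).continuous
  refine integral_mul_fderiv_eq_neg_fderiv_mul_of_integrable ?_ ?_ ?_
    (fun x _ => hf.differentiable (by simp) x) (fun x _ => hg.differentiable (by simp) x)
  · exact (h1.mul hg.continuous).integrable_of_hasCompactSupport ((hfs.fderiv_dir v).mul_right)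
  · exact (hf.continuous.mul h2).integrable_of_hasCompactSupport hfs.mul_right
  · exact (hf.continuous.mul hg.continuous).integrable_of_hasCompactSupport hfs.mul_right

/-- Both sides equal −∫ f ∂_v∂_w g, by integration by parts and the symmetry of second derivatives.
This is the identity behind Korn's inequality. -/
theorem integral_fderiv_mul_fderiv_comm {f g : E → ℝ}
    (hf : ContDiff ℝ (⊤ : ℕ∞) f) (hg : ContDiff ℝ (⊤ : ℕ∞) g) (hfs : HasCompactSupport f)
    (v w : E) :
    ∫ x, fderiv ℝ f x v * fderiv ℝ g x w ∂μ = ∫ x, fderiv ℝ f x w * fderiv ℝ g x v ∂μ := by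
  have h1 := integral_mul_fderiv_eq_neg_of_hasCompactSupport (μ := μ) hf (hg.fderiv_dir w) hfs v
  have h2 := integral_mul_fderiv_eq_neg_of_hasCompactSupport (μ := μ) hf (hg.fderiv_dir v) hfs w
  have h3 : ∀ x, fderiv ℝ (fun y => fderiv ℝ g y w) x v = fderiv ℝ (fun y => fderiv ℝ g y v) x w := by
    intro x
    have hd : DifferentiableAt ℝ (fderiv ℝ g) x :=
      (hg.fderiv_right (m := (⊤ : ℕ∞)) (by norm_cast)).differentiable (by simp) x
    rw [fderiv_clm_apply hd (differentiableAt_const _), fderiv_clm_apply hd (differentiableAt_const _)]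
    simpa using (hg.contDiffAt.isSymmSndFDerivAt
      (by rw [minSmoothness_of_isRCLikeNormedField]; exact WithTop.coe_le_coe.2 (le_top (a := (2 : ℕ∞))))).eq v w
  simp only [h3] at h1
  linarith

/-- `h` is a weak derivative of `w` in the direction `v` on the whole space. -/
def HasWeakDeriv (μ : Measure E) (w h : E → ℝ) (v : E) : Prop :=
  ∀ ψ : E → ℝ, ContDiff ℝ (⊤ : ℕ∞) ψ → HasCompactSupport ψ →
    ∫ x, w x * fderiv ℝ ψ x v ∂μ = - ∫ x, h x * ψ x ∂μ

/-- The derivative falls on ψ, and the weak derivative is tested against t ↦ ψ(x − t); the sign from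
the reflection cancels the one from the integration by parts. -/
theorem HasWeakDeriv.fderiv_convolution {w h ψ : E → ℝ} {v : E} (hw : HasWeakDeriv μ w h v)
    (hwl : LocallyIntegrable w μ) (hψ : ContDiff ℝ (⊤ : ℕ∞) ψ) (hψs : HasCompactSupport ψ) (x : E) :
    fderiv ℝ (w ⋆[ContinuousLinearMap.mul ℝ ℝ, μ] ψ) x v =
      (h ⋆[ContinuousLinearMap.mul ℝ ℝ, μ] ψ) x := by
  have hψd : Differentiable ℝ ψ := hψ.differentiable (by simp)
  have h1 := hψs.hasFDerivAt_convolution_right (ContinuousLinearMap.mul ℝ ℝ) hwl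
    (hψ.of_le (by norm_cast)) x
  rw [h1.fderiv, convolution_precompR_apply _ hwl (hψs.fderiv ℝ)
    (hψ.continuous_fderiv (by simp))]
  have h2 := hw (fun t => ψ (x - t)) (hψ.comp (contDiff_const.sub contDiff_id))
    (hψs.comp_homeomorph (Homeomorph.subLeft x))
  have h3 : ∀ t, fderiv ℝ (fun t => ψ (x - t)) t v = - fderiv ℝ ψ (x - t) v := by
    intro t
    have := ((hψd (x - t)).hasFDerivAt.comp t ((hasFDerivAt_const x t).sub (hasFDerivAt_id t)))
    have h4 := this.fderiv
    simp only [Function.comp_def] at h4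
    rw [h4]
    simp
  simp only [h3, mul_neg, integral_neg, neg_inj] at h2
  exact h2

end Calculus

/-! ### Korn's inequality for test fields. -/

namespace Elasticity

variable {d : ℕ}

theorem symPart_apply (A : Mat d) (i j : Fin d) : symPart A i j = 2⁻¹ * (A i j + A j i) := by
  simp [symPart]

theorem grad_apply {φ : Vec d → Vec d} {x : Vec d} (hφ : DifferentiableAt ℝ φ x) (i j : Fin d) :
    grad φ x i j = fderiv ℝ (fun y => φ y i) x (basisVec j) := by
  have h := ((EuclideanSpace.proj (𝕜 := ℝ) i).hasFDerivAt (x := φ x)).comp x hφ.hasFDerivAt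
  have h2 : fderiv ℝ (fun y => φ y i) x = _ := h.fderiv
  rw [h2]
  rfl

theorem normSq_nonneg (A : Mat d) : 0 ≤ normSq A :=
  Finset.sum_nonneg fun _ _ => Finset.sum_nonneg fun _ _ => sq_nonneg _

section TestField

variable {Ω : Opens (Vec d)} (φ : 𝓓(Ω, Vec d))

theorem contDiff_component (i : Fin d) : ContDiff ℝ (⊤ : ℕ∞) fun x => φ x i :=
  contDiff_euclidean.1 φ.contDiff i

theorem hasCompactSupport_component (i : Fin d) : HasCompactSupport fun x => φ x i :=
  φ.hasCompactSupport.comp_left (g := fun v : Vec d => v i) rfl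

theorem grad_testField (x : Vec d) (i j : Fin d) :
    grad φ x i j = fderiv ℝ (fun y => φ y i) x (basisVec j) :=
  grad_apply (φ.contDiff.differentiable (by simp) x) i j

theorem memLp_grad_testField (i j : Fin d) : MemLp (fun x => grad φ x i j) 2 volume := by
  simp only [grad_testField]
  exact ((contDiff_component φ i).fderiv_dir _).continuous.memLp_of_hasCompactSupport
    ((hasCompactSupport_component φ i).fderiv_dir _)

end TestField

theorem integral_normSq {α : Type*} [MeasurableSpace α] {μ : Measure α} {A : α → Mat d}
    (hA : ∀ i j, MemLp (fun x => A x i j) 2 μ) :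
    ∫ x, normSq (A x) ∂μ = ∑ i, ∑ j, ∫ x, A x i j * A x i j ∂μ := by
  have h : ∀ i j, Integrable (fun x => A x i j * A x i j) μ := fun i j =>
    (hA i j).integrable_mul (hA i j)
  simp only [normSq, sq]
  rw [integral_finsetSum _ fun i _ => integrable_finsetSum _ fun j _ => h i j]
  exact Finset.sum_congr rfl fun i _ => integral_finsetSum _ fun j _ => h i j

theorem integrable_normSq {α : Type*} [MeasurableSpace α] {μ : Measure α} {A : α → Mat d}
    (hA : ∀ i j, MemLp (fun x => A x i j) 2 μ) : Integrable (fun x => normSq (A x)) μ :=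
  integrable_finsetSum _ fun i _ => integrable_finsetSum _ fun j _ => (hA i j).integrable_sq

theorem integrable_dot {α : Type*} [MeasurableSpace α] {μ : Measure α} {A B : α → Mat d}
    (hA : ∀ i j, MemLp (fun x => A x i j) 2 μ) (hB : ∀ i j, MemLp (fun x => B x i j) 2 μ) :
    Integrable (fun x => dot (A x) (B x)) μ :=
  integrable_finsetSum _ fun i _ => integrable_finsetSum _ fun j _ =>
    (hA i j).integrable_mul (hB i j)

theorem memLp_symPart {α : Type*} [MeasurableSpace α] {μ : Measure α} {A : α → Mat d}
    (hA : ∀ i j, MemLp (fun x => A x i j) 2 μ) (i j : Fin d) :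
    MemLp (fun x => symPart (A x) i j) 2 μ := by
  simp only [symPart_apply]
  exact ((hA i j).add (hA j i)).const_mul _

theorem normSq_symPart (A : Mat d) :
    2 * normSq (symPart A) = normSq A + ∑ i, ∑ j, A i j * A j i := by
  have h : ∑ i, ∑ j, A j i ^ 2 = ∑ i, ∑ j, A i j ^ 2 := Finset.sum_comm
  have h1 : 2 * normSq (symPart A) =
      2⁻¹ * (∑ i, ∑ j, A i j ^ 2) + 2⁻¹ * (∑ i, ∑ j, A j i ^ 2) + ∑ i, ∑ j, A i j * A j i := by
    simp only [normSq, symPart_apply, Finset.mul_sum, ← Finset.sum_add_distrib]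
    exact Finset.sum_congr rfl fun i _ => Finset.sum_congr rfl fun j _ => by ring
  rw [h1, h, normSq]
  ring

theorem korn_testField {Ω : Opens (Vec d)} (φ : 𝓓(Ω, Vec d)) :
    ∫ x, normSq (grad φ x) ≤ 2 * ∫ x, normSq (symPart (grad φ x)) := by
  have hL := memLp_grad_testField φ
  have hi : ∀ i j k l, Integrable fun x => grad φ x i j * grad φ x k l := fun i j k l =>
    (hL i j).integrable_mul (hL k l)
  -- Exchanging the two directions of differentiation turns ∂_jφ_i ∂_iφ_j into ∂_iφ_i ∂_jφ_j, whose
  -- sum is the squared divergence.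
  have hcross : ∫ x, (∑ i, ∑ j, grad φ x i j * grad φ x j i) =
      ∫ x, (∑ i, grad φ x i i) ^ 2 := by
    simp only [sq, Finset.sum_mul_sum]
    rw [integral_finsetSum _ fun i _ => integrable_finsetSum _ fun j _ => hi i j j i,
      integral_finsetSum _ fun i _ => integrable_finsetSum _ fun j _ => hi i i j j]
    refine Finset.sum_congr rfl fun i _ => ?_
    rw [integral_finsetSum _ fun j _ => hi i j j i, integral_finsetSum _ fun j _ => hi i i j j]
    refine Finset.sum_congr rfl fun j _ => ?_
    simp only [grad_testField]
    exact integral_fderiv_mul_fderiv_comm (contDiff_component φ i) (contDiff_component φ j)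
      (hasCompactSupport_component φ i) _ _
  have h0 : 0 ≤ ∫ x, (∑ i, grad φ x i i) ^ 2 := integral_nonneg fun x => sq_nonneg _
  rw [← integral_const_mul]
  simp only [normSq_symPart]
  rw [integral_add (integrable_normSq hL)
    (integrable_finsetSum _ fun i _ => integrable_finsetSum _ fun j _ => hi i j j i), hcross]
  linarith

/-! ### Density of test fields, and extension of Korn's inequality and of the equation. -/

/-- `w` lies in `H¹` of the whole space, with weak gradient `H`, and vanishes outside a compact
subset of `U`. -/
structure IsH1CompactIn (U : Set (Vec d)) (w : Vec d → Vec d) (H : Vec d → Mat d) : Prop where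
  memLp : ∀ i, MemLp (fun x => w x i) 2 volume
  memLp_grad : ∀ i j, MemLp (fun x => H x i j) 2 volume
  weak_grad : ∀ i j, HasWeakDeriv volume (fun x => w x i) (fun x => H x i j) (basisVec j)
  supp : ∃ K, IsCompact K ∧ K ⊆ U ∧ ∀ x ∉ K, w x = 0

/-- The gradient of a mollification of w is the mollification of H, hence converges to H in L². Only
gradients need to converge, since all the estimates to be extended are in terms of them. -/
theorem IsH1CompactIn.exists_testField_tendsto {U : Set (Vec d)} {w : Vec d → Vec d}
    {H : Vec d → Mat d} (hw : IsH1CompactIn U w H) (hU : IsOpen U) {Ω : Opens (Vec d)}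
    (hUΩ : U ⊆ Ω) :
    ∃ φ : ℕ → 𝓓(Ω, Vec d), (∀ n, tsupport (φ n) ⊆ U) ∧ ∀ i j, Filter.Tendsto
      (fun n => eLpNorm ((fun x => grad (φ n) x i j) - fun x => H x i j) 2 volume)
        Filter.atTop (nhds 0) := by
  obtain ⟨K, hK, hKU, hK0⟩ := hw.supp
  obtain ⟨δ, hδ, hδU⟩ := hK.exists_cthickening_subset_open hU hKU
  -- The outer radii tend to 0 and never exceed δ, so every mollification is supported in the closed
  -- δ-thickening of K, which lies in U.
  let β : ℕ → ContDiffBump (0 : Vec d) := fun n =>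
    ⟨δ / (n + 1) / 2, δ / (n + 1), by positivity, half_lt_self (by positivity)⟩
  have hβ : Filter.Tendsto (fun n => (β n).rOut) Filter.atTop (nhds 0) := by
    have := (tendsto_one_div_add_atTop_nhds_zero_nat (𝕜 := ℝ)).const_mul δ
    simpa [β, div_eq_mul_inv] using this
  have hβδ : ∀ n, (β n).rOut ≤ δ := fun n => div_le_self hδ.le (by simp)
  have hwl : ∀ i, LocallyIntegrable (fun x => w x i) volume := fun i =>
    (hw.memLp i).locallyIntegrable (by norm_num)
  let F : ℕ → Vec d → Vec d := fun n x => WithLp.toLp 2 fun i =>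
    ((fun x => w x i) ⋆[ContinuousLinearMap.mul ℝ ℝ, volume] (β n).normed volume) x
  have hFs : ∀ n, ContDiff ℝ (⊤ : ℕ∞) (F n) := fun n => contDiff_euclidean.2 fun i =>
    (β n).hasCompactSupport_normed.contDiff_convolution_right _ (hwl i) (β n).contDiff_normed
  have hF0 : ∀ n, ∀ x ∉ Metric.cthickening δ K, F n x = 0 := by
    intro n x hx
    ext i
    by_contra hne
    apply hx
    obtain ⟨y, hy, z, hz, rfl⟩ := support_convolution_subset _
      (Function.mem_support.2 hne)
    have hyK : y ∈ K := by
      by_contra hyK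
      exact hy (by simp [hK0 y hyK])
    rw [(β n).support_normed_eq] at hz
    refine Metric.mem_cthickening_of_dist_le _ y δ K hyK ?_
    have hz' : ‖z‖ < (β n).rOut := by simpa using hz
    simpa using hz'.le.trans (hβδ n)
  have hcomp : IsCompact (Metric.cthickening δ K) := hK.cthickening
  have hFt : ∀ n, tsupport (F n) ⊆ Metric.cthickening δ K := fun n =>
    closure_minimal (fun x hx => by_contra fun h => hx (hF0 n x h)) hcomp.isClosed
  have hFc : ∀ n, HasCompactSupport (F n) := fun n => HasCompactSupport.intro hcomp (hF0 n)
  refine ⟨fun n => ⟨F n, hFs n, hFc n, (hFt n).trans (hδU.trans hUΩ)⟩,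
    fun n => (hFt n).trans hδU, fun i j => ?_⟩
  have hg : ∀ n, (fun x => grad (F n) x i j) =
      (fun x => H x i j) ⋆[ContinuousLinearMap.mul ℝ ℝ, volume] (β n).normed volume := by
    intro n
    ext x
    rw [grad_apply ((hFs n).differentiable (by simp) x)]
    exact (hw.weak_grad i j).fderiv_convolution (hwl i) (β n).contDiff_normed
      (β n).hasCompactSupport_normed x
  simp only [TestFunction.coe_mk, hg]
  exact tendsto_eLpNorm_convolution_sub (hw.memLp_grad i j) hβ

theorem tendsto_eLpNorm_symPart {α : Type*} [MeasurableSpace α] {μ : Measure α}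
    {A : ℕ → α → Mat d} {B : α → Mat d} (hA : ∀ n i j, MemLp (fun x => A n x i j) 2 μ)
    (hB : ∀ i j, MemLp (fun x => B x i j) 2 μ)
    (h : ∀ i j, Filter.Tendsto (fun n => eLpNorm ((fun x => A n x i j) - fun x => B x i j) 2 μ)
      Filter.atTop (nhds 0)) (i j : Fin d) :
    Filter.Tendsto
      (fun n => eLpNorm ((fun x => symPart (A n x) i j) - fun x => symPart (B x) i j) 2 μ)
      Filter.atTop (nhds 0) := by
  have h0 : Filter.Tendsto (fun n => eLpNorm ((fun x => A n x i j) - fun x => B x i j) 2 μ +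
      eLpNorm ((fun x => A n x j i) - fun x => B x j i) 2 μ) Filter.atTop (nhds 0) := by
    simpa using (h i j).add (h j i)
  refine tendsto_of_tendsto_of_tendsto_of_le_of_le tendsto_const_nhds h0 (fun _ => zero_le)
    fun n => ?_
  have heq : ((fun x => symPart (A n x) i j) - fun x => symPart (B x) i j) =
      (2⁻¹ : ℝ) • (((fun x => A n x i j) - fun x => B x i j) +
        ((fun x => A n x j i) - fun x => B x j i)) := by
    ext x
    simp [symPart_apply]
    ring
  rw [heq]
  refine (eLpNorm_const_smul_le).trans ?_
  refine (mul_le_of_le_one_left zero_le ?_).trans (eLpNorm_add_le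
    ((hA n i j).sub (hB i j)).1 ((hA n j i).sub (hB j i)).1 (by norm_num))
  rw [← ofReal_norm, ENNReal.ofReal_le_one]
  norm_num

theorem tendsto_integral_normSq {α : Type*} [MeasurableSpace α] {μ : Measure α}
    {A : ℕ → α → Mat d} {B : α → Mat d} (hA : ∀ n i j, MemLp (fun x => A n x i j) 2 μ)
    (hB : ∀ i j, MemLp (fun x => B x i j) 2 μ)
    (h : ∀ i j, Filter.Tendsto (fun n => eLpNorm ((fun x => A n x i j) - fun x => B x i j) 2 μ)
      Filter.atTop (nhds 0)) :
    Filter.Tendsto (fun n => ∫ x, normSq (A n x) ∂μ) Filter.atTop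
      (nhds (∫ x, normSq (B x) ∂μ)) := by
  rw [integral_normSq hB]
  simp_rw [fun n => integral_normSq (hA n)]
  exact tendsto_finsetSum _ fun i _ => tendsto_finsetSum _ fun j _ =>
    tendsto_integral_mul_of_tendsto_eLpNorm (fun n => hA n i j) (fun n => hA n i j)
      (hB i j) (hB i j) (h i j) (h i j)

theorem integral_dot {α : Type*} [MeasurableSpace α] {μ : Measure α} {A B : α → Mat d}
    (hA : ∀ i j, MemLp (fun x => A x i j) 2 μ) (hB : ∀ i j, MemLp (fun x => B x i j) 2 μ) :
    ∫ x, dot (A x) (B x) ∂μ = ∑ i, ∑ j, ∫ x, A x i j * B x i j ∂μ := by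
  have h : ∀ i j, Integrable (fun x => A x i j * B x i j) μ := fun i j =>
    (hA i j).integrable_mul (hB i j)
  simp only [dot]
  rw [integral_finsetSum _ fun i _ => integrable_finsetSum _ fun j _ => h i j]
  exact Finset.sum_congr rfl fun i _ => integral_finsetSum _ fun j _ => h i j

theorem tendsto_integral_dot {α : Type*} [MeasurableSpace α] {μ : Measure α}
    {S : α → Mat d} {A : ℕ → α → Mat d} {B : α → Mat d}
    (hS : ∀ i j, MemLp (fun x => S x i j) 2 μ) (hA : ∀ n i j, MemLp (fun x => A n x i j) 2 μ)
    (hB : ∀ i j, MemLp (fun x => B x i j) 2 μ)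
    (h : ∀ i j, Filter.Tendsto (fun n => eLpNorm ((fun x => A n x i j) - fun x => B x i j) 2 μ)
      Filter.atTop (nhds 0)) :
    Filter.Tendsto (fun n => ∫ x, dot (S x) (A n x) ∂μ) Filter.atTop
      (nhds (∫ x, dot (S x) (B x) ∂μ)) := by
  rw [integral_dot hS hB]
  simp_rw [fun n => integral_dot hS (hA n)]
  exact tendsto_finsetSum _ fun i _ => tendsto_finsetSum _ fun j _ =>
    tendsto_integral_mul_of_tendsto_eLpNorm (fun _ => hS i j) (fun n => hA n i j)
      (hS i j) (hB i j) (by simp) (h i j)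

theorem IsH1CompactIn.korn {U : Set (Vec d)} {w : Vec d → Vec d} {H : Vec d → Mat d}
    (hw : IsH1CompactIn U w H) (hU : IsOpen U) :
    ∫ x, normSq (H x) ≤ 2 * ∫ x, normSq (symPart (H x)) := by
  obtain ⟨φ, -, hφ⟩ := hw.exists_testField_tendsto hU (Ω := ⊤) (Set.subset_univ _)
  have hA := fun n => memLp_grad_testField (φ n)
  exact le_of_tendsto_of_tendsto' (tendsto_integral_normSq hA hw.memLp_grad hφ)
    ((tendsto_integral_normSq (fun n => memLp_symPart (hA n)) (memLp_symPart hw.memLp_grad)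
      (tendsto_eLpNorm_symPart hA hw.memLp_grad hφ)).const_mul 2) fun n => korn_testField (φ n)

theorem memLp_app {Ω : Opens (Vec d)} {C : Vec d → Tensor4 d} {Λ : ℝ}
    (hC : IsBoundedTensor Ω C Λ) {A : Vec d → Mat d}
    (hA : ∀ i j, MemLp (fun x => A x i j) 2 (volume.restrict (Ω : Set (Vec d)))) (i j : Fin d) :
    MemLp (fun x => (C x).app (A x) i j) 2 (volume.restrict (Ω : Set (Vec d))) := by
  simp only [Tensor4.app, Matrix.of_apply]
  refine memLp_finsetSum _ fun k _ => memLp_finsetSum _ fun l _ => ?_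
  refine (hA k l).of_le_mul (c := Λ) ((hC.meas i j k l).mul (hA k l).1) ?_
  filter_upwards [hC.bound i j k l] with x hx
  rw [norm_mul]
  exact mul_le_mul_of_nonneg_right hx (norm_nonneg _)

theorem IsWeakSolution.abs_integral_le {Ω : Opens (Vec d)} {C : Vec d → Tensor4 d} {Λ : ℝ}
    (hC : IsBoundedTensor Ω C Λ) {f : 𝓓(Ω, Vec d) →ₗ[ℝ] ℝ} {G : Vec d → Mat d}
    (hG : ∀ i j, MemLp (fun x => G x i j) 2 (volume.restrict (Ω : Set (Vec d))))
    (hsol : IsWeakSolution Ω C G f) {U : Set (Vec d)} (hU : IsOpen U) (hUΩ : U ⊆ Ω) {K : ℝ}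
    (hK : IsHNegOneBound f U K) {w : Vec d → Vec d} {H : Vec d → Mat d}
    (hw : IsH1CompactIn U w H) :
    |∫ x in (Ω : Set (Vec d)), dot ((C x).app (symPart (G x))) (symPart (H x))| ≤
      K * Real.sqrt (∫ x, normSq (H x)) := by
  obtain ⟨φ, hφU, hφ⟩ := hw.exists_testField_tendsto hU hUΩ
  have hA := fun n => memLp_grad_testField (φ n)
  have hS := memLp_app hC (memLp_symPart hG)
  have h1 : Filter.Tendsto (fun n => ∫ x in (Ω : Set (Vec d)),
      dot ((C x).app (symPart (G x))) (symPart (grad (φ n) x))) Filter.atTop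
      (nhds (∫ x in (Ω : Set (Vec d)), dot ((C x).app (symPart (G x))) (symPart (H x)))) := by
    refine tendsto_integral_dot hS (fun n i j => (memLp_symPart (hA n) i j).restrict _)
      (fun i j => (memLp_symPart hw.memLp_grad i j).restrict _) fun i j => ?_
    exact tendsto_of_tendsto_of_tendsto_of_le_of_le tendsto_const_nhds
      (tendsto_eLpNorm_symPart hA hw.memLp_grad hφ i j) (fun _ => zero_le)
      fun n => eLpNorm_mono_measure _ Measure.restrict_le_self
  have h2 := (tendsto_integral_normSq hA hw.memLp_grad hφ).sqrt.const_mul K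
  refine le_of_tendsto_of_tendsto' h1.abs h2 fun n => ?_
  rw [hsol (φ n), abs_neg]
  exact hK.2 (φ n) (hφU n)

/-! ### Cutting off H¹ fields. -/

theorem memLp_mul_of_support_subset {Ω : Opens (Vec d)} {c g : Vec d → ℝ} (hc : Continuous c)
    (hcs : HasCompactSupport c) (hcΩ : ∀ x ∉ (Ω : Set (Vec d)), c x = 0)
    (hg : MemLp g 2 (volume.restrict (Ω : Set (Vec d)))) :
    MemLp (fun x => c x * g x) 2 volume := by
  obtain ⟨M, hM⟩ := hc.bounded_above_of_compact_support hcs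
  have h1 : MemLp (fun x => c x * g x) 2 (volume.restrict (Ω : Set (Vec d))) := by
    refine hg.of_le_mul (c := M) (hc.aestronglyMeasurable.mul hg.1) (.of_forall fun x => ?_)
    rw [norm_mul]
    exact mul_le_mul_of_nonneg_right (hM x) (norm_nonneg _)
  rw [← memLp_indicator_iff_restrict Ω.isOpen.measurableSet] at h1
  have heq : (Ω : Set (Vec d)).indicator (fun x => c x * g x) = fun x => c x * g x :=
    Set.indicator_eq_self.2 fun x hx => by_contra fun h => hx (by simp only [hcΩ x h, zero_mul])
  rwa [heq] at h1

/-- Constants are in L² because Ω is bounded, and they do not affect the weak gradient because the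
derivatives of a test function have integral zero. -/
theorem IsH1.sub_const {Ω : Opens (Vec d)} (hΩ : Bornology.IsBounded (Ω : Set (Vec d)))
    {u : Vec d → Vec d} {G : Vec d → Mat d} (hu : IsH1 Ω u G) (a : Vec d) :
    IsH1 Ω (fun x => u x - a) G := by
  have : IsFiniteMeasure (volume.restrict (Ω : Set (Vec d))) :=
    ⟨by simpa using hΩ.measure_lt_top⟩
  refine ⟨fun i => (hu.memLp i).sub (memLp_const (a i)), hu.memLp_grad, fun i j η => ?_⟩
  have hη : ContDiff ℝ (⊤ : ℕ∞) η := η.contDiff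
  have hηs : HasCompactSupport η := η.hasCompactSupport
  have hD : MemLp (fun x => fderiv ℝ η x (basisVec j)) 2 (volume.restrict (Ω : Set (Vec d))) :=
    ((hη.fderiv_dir _).continuous.memLp_of_hasCompactSupport (hηs.fderiv_dir _)).restrict _
  have h0 : ∫ x in (Ω : Set (Vec d)), fderiv ℝ η x (basisVec j) = 0 := by
    rw [setIntegral_eq_integral_of_forall_compl_eq_zero fun x hx => by
      rw [fderiv_of_notMem_tsupport ℝ fun h => hx (η.tsupport_subset h)]; rfl]
    have := integral_mul_fderiv_eq_neg_of_hasCompactSupport (μ := volume) hη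
      (contDiff_const (c := (1 : ℝ))) hηs (basisVec j)
    simpa using this
  have h1 : Integrable (fun x => u x i * fderiv ℝ η x (basisVec j))
    (volume.restrict (Ω : Set (Vec d))) := (hu.memLp i).integrable_mul hD
  have h2 : Integrable (fun x => a i * fderiv ℝ η x (basisVec j))
    (volume.restrict (Ω : Set (Vec d))) := (hD.integrable (by norm_num)).const_mul _
  simp only [PiLp.sub_apply, sub_mul]
  rw [integral_sub h1 h2, integral_const_mul, h0, mul_zero, sub_zero]
  exact hu.weak_grad i j η

/-- The matrix `v ⊗ ∇η`. -/
noncomputable def tensorGrad (η : Vec d → ℝ) (v : Vec d → Vec d) (x : Vec d) : Mat d :=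
  Matrix.of fun i j => fderiv ℝ η x (basisVec j) * v x i

theorem IsH1.memLp_tensorGrad {Ω : Opens (Vec d)} {v : Vec d → Vec d} {G : Vec d → Mat d}
    (hv : IsH1 Ω v G) {η : Vec d → ℝ} (hη : ContDiff ℝ (⊤ : ℕ∞) η) (hηs : HasCompactSupport η)
    (hηΩ : tsupport η ⊆ Ω) (i j : Fin d) :
    MemLp (fun x => tensorGrad η v x i j) 2 volume :=
  memLp_mul_of_support_subset (hη.fderiv_dir _).continuous (hηs.fderiv_dir _)
    (fun x hx => by rw [fderiv_of_notMem_tsupport ℝ fun h => hx (hηΩ h)]; rfl) (hv.memLp i)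

theorem IsH1.memLp_mul_grad {Ω : Opens (Vec d)} {v : Vec d → Vec d} {G : Vec d → Mat d}
    (hv : IsH1 Ω v G) {η : Vec d → ℝ} (hη : ContDiff ℝ (⊤ : ℕ∞) η) (hηs : HasCompactSupport η)
    (hηΩ : tsupport η ⊆ Ω) (i j : Fin d) :
    MemLp (fun x => (η x • G x) i j) 2 volume :=
  memLp_mul_of_support_subset hη.continuous hηs
    (fun _ hx => image_eq_zero_of_notMem_tsupport fun h => hx (hηΩ h)) (hv.memLp_grad i j)

/-- For ψ arbitrary on the whole space, ηψ is a test function on Ω; testing the weak gradient of v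
against it yields the product rule. -/
theorem IsH1.smul_cutoff {Ω : Opens (Vec d)} {v : Vec d → Vec d} {G : Vec d → Mat d}
    (hv : IsH1 Ω v G) {η : Vec d → ℝ} (hη : ContDiff ℝ (⊤ : ℕ∞) η) (hηs : HasCompactSupport η)
    {U : Set (Vec d)} (hηU : tsupport η ⊆ U) (hUΩ : U ⊆ Ω) :
    IsH1CompactIn U (fun x => η x • v x) (fun x => η x • G x + tensorGrad η v x) := by
  have hηΩ := hηU.trans hUΩ
  have hη0 : ∀ x ∉ (Ω : Set (Vec d)), η x = 0 := fun x hx =>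
    image_eq_zero_of_notMem_tsupport fun h => hx (hηΩ h)
  have hT := hv.memLp_tensorGrad hη hηs hηΩ
  have hG := hv.memLp_mul_grad hη hηs hηΩ
  have hw : ∀ i, MemLp (fun x => (η x • v x) i) 2 volume := fun i =>
    memLp_mul_of_support_subset hη.continuous hηs hη0 (hv.memLp i)
  refine ⟨hw, fun i j => (hG i j).add (hT i j), fun i j ψ hψ hψs => ?_,
    tsupport η, hηs, hηU, fun x hx => by simp [image_eq_zero_of_notMem_tsupport hx]⟩
  have hψL : MemLp ψ 2 volume := hψ.continuous.memLp_of_hasCompactSupport hψs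
  have hDψ : MemLp (fun x => fderiv ℝ ψ x (basisVec j)) 2 volume :=
    (hψ.fderiv_dir _).continuous.memLp_of_hasCompactSupport (hψs.fderiv_dir _)
  have hweak := hv.weak_grad i j
    ⟨fun x => η x * ψ x, hη.mul hψ, hηs.mul_right, (tsupport_mul_subset_left).trans hηΩ⟩
  simp only [TestFunction.coe_mk] at hweak
  have hd : ∀ x, fderiv ℝ (fun x => η x * ψ x) x (basisVec j) =
      η x * fderiv ℝ ψ x (basisVec j) + ψ x * fderiv ℝ η x (basisVec j) := by
    intro x
    rw [fderiv_fun_mul (hη.differentiable (by simp) x) (hψ.differentiable (by simp) x)]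
    rfl
  rw [setIntegral_eq_integral_of_forall_compl_eq_zero, setIntegral_eq_integral_of_forall_compl_eq_zero]
    at hweak
  · have e1 : ∀ x, v x i * fderiv ℝ (fun x => η x * ψ x) x (basisVec j) =
        (η x • v x) i * fderiv ℝ ψ x (basisVec j) + tensorGrad η v x i j * ψ x := by
      intro x
      rw [hd]
      simp [tensorGrad]
      ring
    have e2 : ∀ x, G x i j * (η x * ψ x) = (η x • G x) i j * ψ x := by
      intro x
      simp
      ring
    simp only [e1, e2] at hweak
    have i1 : Integrable fun x => (η x • v x) i * fderiv ℝ ψ x (basisVec j) :=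
      (hw i).integrable_mul hDψ
    have i2 : Integrable fun x => tensorGrad η v x i j * ψ x := (hT i j).integrable_mul hψL
    have i3 : Integrable fun x => (η x • G x) i j * ψ x := (hG i j).integrable_mul hψL
    rw [integral_add i1 i2] at hweak
    simp only [Matrix.add_apply, add_mul]
    rw [integral_add i3 i2]
    linarith
  · intro x hx
    simp [hη0 x hx]
  · intro x hx
    rw [hd, hη0 x hx, fderiv_of_notMem_tsupport ℝ fun h => hx (hηΩ h)]
    simp

theorem exists_cutoff (d : ℕ) : ∃ c : ℝ, 0 < c ∧ ∀ (x₀ : Vec d) (ρ : ℝ), 0 < ρ →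
    ∃ η : Vec d → ℝ, ContDiff ℝ (⊤ : ℕ∞) η ∧ HasCompactSupport η ∧
      tsupport η ⊆ Metric.ball x₀ (2 * ρ) ∧ (∀ x, 0 ≤ η x ∧ η x ≤ 1) ∧
      (∀ x ∈ Metric.ball x₀ ρ, η x = 1) ∧
      ∀ x, ∑ j, fderiv ℝ η x (basisVec j) ^ 2 ≤ c / ρ ^ 2 := by
  -- One fixed bump is rescaled for every ball, so c depends on d alone. The outer radius is below 2
  -- to keep the closed support inside the open ball of radius 2ρ.
  let β : ContDiffBump (0 : Vec d) := ⟨1, 3 / 2, one_pos, by norm_num⟩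
  have hβ : ContDiff ℝ (⊤ : ℕ∞) β := β.contDiff
  have hcont : Continuous fun y => ∑ j, fderiv ℝ β y (basisVec j) ^ 2 :=
    continuous_finsetSum _ fun j _ => (hβ.fderiv_dir _).continuous.pow 2
  have hcs : HasCompactSupport fun y => ∑ j, fderiv ℝ β y (basisVec j) ^ 2 :=
    (β.hasCompactSupport.fderiv ℝ).comp_left
      (g := fun L : Vec d →L[ℝ] ℝ => ∑ j, L (basisVec j) ^ 2) (by simp)
  obtain ⟨M, hM⟩ := hcont.bounded_above_of_compact_support hcs
  refine ⟨|M| + 1, by positivity, fun x₀ ρ hρ => ?_⟩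
  have hsupp : ∀ x ∉ Metric.closedBall x₀ (3 / 2 * ρ), β (ρ⁻¹ • (x - x₀)) = 0 := by
    intro x hx
    refine β.zero_of_le_dist ?_
    rw [Metric.mem_closedBall, not_le, dist_eq_norm] at hx
    rw [dist_zero_right, norm_smul, Real.norm_of_nonneg (by positivity), inv_mul_eq_div,
      le_div_iff₀ hρ]
    exact hx.le
  have hts : tsupport (fun x => β (ρ⁻¹ • (x - x₀))) ⊆ Metric.closedBall x₀ (3 / 2 * ρ) :=
    closure_minimal (fun x hx => by_contra fun h => hx (hsupp x h)) Metric.isClosed_closedBall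
  refine ⟨fun x => β (ρ⁻¹ • (x - x₀)),
    hβ.comp ((contDiff_id.sub contDiff_const).const_smul ρ⁻¹),
    HasCompactSupport.intro (isCompact_closedBall _ _) hsupp,
    hts.trans (Metric.closedBall_subset_ball (by linarith)),
    fun x => ⟨β.nonneg, β.le_one⟩, fun x hx => ?_, fun x => ?_⟩
  · refine β.one_of_mem_closedBall ?_
    rw [Metric.mem_ball, dist_eq_norm] at hx
    rw [Metric.mem_closedBall, dist_zero_right, norm_smul, Real.norm_of_nonneg (by positivity),
      inv_mul_eq_div, div_le_iff₀ hρ]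
    simpa [β] using hx.le
  · have hfd : ∀ j, fderiv ℝ (fun x => β (ρ⁻¹ • (x - x₀))) x (basisVec j) =
        ρ⁻¹ * fderiv ℝ β (ρ⁻¹ • (x - x₀)) (basisVec j) := by
      intro j
      have h := (hβ.differentiable (by simp) (ρ⁻¹ • (x - x₀))).hasFDerivAt.comp x
        (((hasFDerivAt_id x).sub (hasFDerivAt_const x₀ x)).const_smul ρ⁻¹)
      have h2 : fderiv ℝ (fun x => β (ρ⁻¹ • (x - x₀))) x = _ := h.fderiv
      rw [h2]
      simp
    simp only [hfd, mul_pow, ← Finset.mul_sum]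
    have h3 := (le_abs_self _).trans (hM (ρ⁻¹ • (x - x₀)))
    rw [inv_pow, inv_mul_eq_div]
    gcongr
    linarith [le_abs_self M]

/-- The infimum defining the dual norm is attained. -/
theorem isHNegOneBound_hNegOneNorm {Ω : Opens (Vec d)} {f : 𝓓(Ω, Vec d) →ₗ[ℝ] ℝ}
    (hf : IsHNegOne f) {U : Set (Vec d)} (hU : U ⊆ Ω) :
    IsHNegOneBound f U (hNegOneNorm f U) := by
  obtain ⟨K, hK0, hK⟩ := hf
  have hne : {K | IsHNegOneBound f U K}.Nonempty := ⟨K, hK0, fun φ hφ => hK φ (hφ.trans hU)⟩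
  refine ⟨le_csInf hne fun K hK => hK.1, fun φ hφ => ?_⟩
  have hg : 0 ≤ gradNorm φ := Real.sqrt_nonneg _
  -- If the gradient norm vanishes, division is impossible, but any one bound already forces f φ =
  -- 0.
  rcases hg.eq_or_lt with h0 | hpos
  · rw [← h0, mul_zero]
    simpa [← h0] using hK φ (hφ.trans hU)
  · rw [← div_le_iff₀ hpos]
    exact le_csInf hne fun K hK => (div_le_iff₀ hpos).2 (hK.2 φ hφ)

/-! ### Matrix algebra and pointwise coercivity. -/

theorem normSq_add_le (A B : Mat d) : normSq (A + B) ≤ 2 * normSq A + 2 * normSq B := by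
  simp only [normSq, Finset.mul_sum, ← Finset.sum_add_distrib]
  refine Finset.sum_le_sum fun i _ => Finset.sum_le_sum fun j _ => ?_
  rw [Matrix.add_apply]
  nlinarith [sq_nonneg (A i j - B i j)]

theorem normSq_smul (c : ℝ) (A : Mat d) : normSq (c • A) = c ^ 2 * normSq A := by
  simp [normSq, Finset.mul_sum, mul_pow]

theorem normSq_transpose (A : Mat d) : normSq A.transpose = normSq A :=
  Finset.sum_comm

theorem normSq_symPart_le (A : Mat d) : normSq (symPart A) ≤ normSq A := by
  have h := normSq_add_le A A.transpose
  rw [normSq_transpose] at h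
  rw [symPart, normSq_smul]
  linarith

theorem symPart_add (A B : Mat d) : symPart (A + B) = symPart A + symPart B := by
  ext i j
  simp only [symPart_apply, Matrix.add_apply]
  ring

theorem symPart_smul (c : ℝ) (A : Mat d) : symPart (c • A) = c • symPart A := by
  ext i j
  simp only [symPart_apply, Matrix.smul_apply, smul_eq_mul]
  ring

theorem isSymm_symPart (A : Mat d) : (symPart A).IsSymm := by
  ext i j
  simp only [Matrix.transpose_apply, symPart_apply]
  ring

theorem Tensor4.app_smul (C : Tensor4 d) (c : ℝ) (A : Mat d) : C.app (c • A) = c • C.app A := by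
  ext i j
  simp only [Tensor4.app, Matrix.of_apply, Matrix.smul_apply, smul_eq_mul, Finset.mul_sum]
  exact Finset.sum_congr rfl fun k _ => Finset.sum_congr rfl fun l _ => by ring

theorem dot_smul_left (c : ℝ) (A B : Mat d) : dot (c • A) B = c * dot A B := by
  simp [dot, Finset.mul_sum, mul_assoc]

theorem dot_smul_right (c : ℝ) (A B : Mat d) : dot A (c • B) = c * dot A B := by
  simp only [dot, Finset.mul_sum, Matrix.smul_apply, smul_eq_mul]
  exact Finset.sum_congr rfl fun k _ => Finset.sum_congr rfl fun l _ => by ring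

theorem dot_add_right (A B B' : Mat d) : dot A (B + B') = dot A B + dot A B' := by
  simp [dot, mul_add, Finset.sum_add_distrib]

/-- Young's inequality with weight α in each entry; every A k l and every B i j occurs d² times in
the quadruple sum. -/
theorem Tensor4.abs_dot_app_le {C : Tensor4 d} {Λ α : ℝ} (hα : 0 < α)
    (hC : ∀ i j k l, |C i j k l| ≤ Λ) (A B : Mat d) :
    |dot (C.app A) B| ≤ d ^ 2 * (α * normSq A + Λ ^ 2 / (4 * α) * normSq B) := by
  have hterm : ∀ i j k l, |C i j k l * A k l * B i j| ≤
      α * A k l ^ 2 + Λ ^ 2 / (4 * α) * B i j ^ 2 := by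
    intro i j k l
    have h1 : C i j k l ^ 2 ≤ Λ ^ 2 := sq_le_sq' (abs_le.1 (hC i j k l)).1 (abs_le.1 (hC i j k l)).2
    have h2 : Λ ^ 2 / (4 * α) * B i j ^ 2 = (Λ ^ 2 * B i j ^ 2) / (4 * α) := by ring
    have h3 : (C i j k l ^ 2 * B i j ^ 2) / (4 * α) ≤ (Λ ^ 2 * B i j ^ 2) / (4 * α) := by gcongr
    have h4 : ∀ a b : ℝ, |a * b| ≤ α * a ^ 2 + b ^ 2 / (4 * α) := by
      intro a b
      have h5 : α * a ^ 2 + b ^ 2 / (4 * α) - a * b = (2 * α * a - b) ^ 2 / (4 * α) := by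
        field_simp
        ring
      have h6 : α * a ^ 2 + b ^ 2 / (4 * α) + a * b = (2 * α * a + b) ^ 2 / (4 * α) := by
        field_simp
        ring
      have h7 : 0 ≤ (2 * α * a - b) ^ 2 / (4 * α) := by positivity
      have h8 : 0 ≤ (2 * α * a + b) ^ 2 / (4 * α) := by positivity
      exact abs_le.2 ⟨by linarith, by linarith⟩
    have h9 := h4 (A k l) (C i j k l * B i j)
    rw [mul_pow] at h9
    rw [h2, show C i j k l * A k l * B i j = A k l * (C i j k l * B i j) by ring]
    exact h9.trans (by linarith)
  have hsum : dot (C.app A) B = ∑ i, ∑ j, ∑ k, ∑ l, C i j k l * A k l * B i j := by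
    simp only [dot, Tensor4.app, Matrix.of_apply, Finset.sum_mul]
  rw [hsum]
  calc |∑ i, ∑ j, ∑ k, ∑ l, C i j k l * A k l * B i j|
      ≤ ∑ i, ∑ j, ∑ k, ∑ l, (α * A k l ^ 2 + Λ ^ 2 / (4 * α) * B i j ^ 2) := by
        refine (Finset.abs_sum_le_sum_abs _ _).trans (Finset.sum_le_sum fun i _ => ?_)
        refine (Finset.abs_sum_le_sum_abs _ _).trans (Finset.sum_le_sum fun j _ => ?_)
        refine (Finset.abs_sum_le_sum_abs _ _).trans (Finset.sum_le_sum fun k _ => ?_)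
        exact (Finset.abs_sum_le_sum_abs _ _).trans (Finset.sum_le_sum fun l _ => hterm i j k l)
    _ = _ := by
        simp only [normSq, Finset.sum_add_distrib, ← Finset.mul_sum, Finset.sum_const,
          Finset.card_univ, Fintype.card_fin, nsmul_eq_mul]
        ring

theorem normSq_tensorGrad (η : Vec d → ℝ) (v : Vec d → Vec d) (x : Vec d) :
    normSq (tensorGrad η v x) = (∑ j, fderiv ℝ η x (basisVec j) ^ 2) * ‖v x‖ ^ 2 := by
  rw [EuclideanSpace.real_norm_sq_eq, Finset.sum_mul_sum, Finset.sum_comm]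
  simp [normSq, tensorGrad, mul_pow]

theorem tensorGrad_sq {η : Vec d → ℝ} (hη : ContDiff ℝ (⊤ : ℕ∞) η) (v : Vec d → Vec d)
    (x : Vec d) : tensorGrad (fun x => η x ^ 2) v x = (2 * η x) • tensorGrad η v x := by
  ext i j
  have h := (hη.differentiable (by simp) x).hasFDerivAt.pow 2
  simp only [tensorGrad, Matrix.of_apply, Matrix.smul_apply, smul_eq_mul]
  rw [h.fderiv]
  simp
  ring

theorem coercive_pointwise {C : Tensor4 d} {lam Λ : ℝ} (hd : 0 < d) (hlam : 0 < lam)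
    (hC : ∀ i j k l, |C i j k l| ≤ Λ)
    (hconv : ∀ A : Mat d, A.IsSymm → lam * normSq A ≤ dot (C.app A) A) (t : ℝ) (G T : Mat d) :
    3 / 4 * lam * normSq (t • symPart G) ≤
      dot (C.app (symPart G)) (symPart (t ^ 2 • G + (2 * t) • T)) +
        4 * d ^ 4 * Λ ^ 2 / lam * normSq T := by
  have hd' : (0 : ℝ) < d := by exact_mod_cast hd
  have h1 := hconv (t • symPart G) (by rw [← symPart_smul]; exact isSymm_symPart _)
  -- With this α the cross term, which occurs twice, costs lam/4 of the coercivity and leaves 3/4 of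
  -- it.
  have h2 := (abs_le.1 (Tensor4.abs_dot_app_le (α := lam / (8 * d ^ 2)) (by positivity) hC
    (t • symPart G) (symPart T))).1
  have h3 : (d : ℝ) ^ 2 * (lam / (8 * d ^ 2) * normSq (t • symPart G) +
      Λ ^ 2 / (4 * (lam / (8 * d ^ 2))) * normSq (symPart T)) =
      lam / 8 * normSq (t • symPart G) + 2 * d ^ 4 * Λ ^ 2 / lam * normSq (symPart T) := by
    field_simp
    ring
  have h4 : 2 * d ^ 4 * Λ ^ 2 / lam * normSq (symPart T) ≤ 2 * d ^ 4 * Λ ^ 2 / lam * normSq T :=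
    mul_le_mul_of_nonneg_left (normSq_symPart_le T) (by positivity)
  have h5 : dot (C.app (symPart G)) (symPart (t ^ 2 • G + (2 * t) • T)) =
      dot (C.app (t • symPart G)) (t • symPart G) +
        2 * dot (C.app (t • symPart G)) (symPart T) := by
    simp only [symPart_add, symPart_smul, dot_add_right, dot_smul_right, Tensor4.app_smul,
      dot_smul_left]
    ring
  have h6 : 4 * d ^ 4 * Λ ^ 2 / lam * normSq T = 2 * (2 * d ^ 4 * Λ ^ 2 / lam * normSq T) := by
    ring
  rw [h3] at h2
  linarith

/-! ### The energy estimate. -/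

theorem cutoff_estimate {Ω : Opens (Vec d)} {C : Vec d → Tensor4 d} {lam Λ : ℝ} (hd : 0 < d)
    (hlam : 0 < lam) (hC : IsBoundedTensor Ω C Λ) (hconv : IsStronglyConvex Ω C lam)
    {f : 𝓓(Ω, Vec d) →ₗ[ℝ] ℝ} {v : Vec d → Vec d} {G : Vec d → Mat d} (hv : IsH1 Ω v G)
    (hsol : IsWeakSolution Ω C G f) {U : Set (Vec d)} (hU : IsOpen U) (hUΩ : U ⊆ Ω) {K : ℝ}
    (hK : IsHNegOneBound f U K) {η : Vec d → ℝ} (hη : ContDiff ℝ (⊤ : ℕ∞) η)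
    (hηs : HasCompactSupport η) (hηU : tsupport η ⊆ U) (hη1 : ∀ x, 0 ≤ η x ∧ η x ≤ 1) :
    ∫ x, normSq (η x • G x + tensorGrad η v x) ≤
      (13 / 2 + 32 * d ^ 4 * Λ ^ 2 / lam ^ 2) * (∫ x, normSq (tensorGrad η v x)) +
        64 / lam ^ 2 * K ^ 2 := by
  have hηΩ := hηU.trans hUΩ
  have hη0 : ∀ x ∉ (Ω : Set (Vec d)), η x = 0 := fun x hx =>
    image_eq_zero_of_notMem_tsupport fun h => hx (hηΩ h)
  have hw1 := hv.smul_cutoff hη hηs hηU hUΩ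
  have hη2s : HasCompactSupport fun x => η x ^ 2 :=
    hηs.comp_left (g := fun t : ℝ => t ^ 2) (by simp)
  have hη2U : tsupport (fun x => η x ^ 2) ⊆ U := by
    simp only [sq]
    exact tsupport_mul_subset_left.trans hηU
  have hw2 := hv.smul_cutoff (hη.pow 2) hη2s hη2U hUΩ
  simp only [tensorGrad_sq hη] at hw2
  have hTm := hv.memLp_tensorGrad hη hηs hηΩ
  have hGm := hv.memLp_mul_grad hη hηs hηΩ
  have hTi := integrable_normSq hTm
  have hem : ∀ i j, MemLp (fun x => (η x • symPart (G x)) i j) 2 volume := by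
    simp only [← symPart_smul]
    exact memLp_symPart hGm
  have hei := integrable_normSq hem
  set X := ∫ x, normSq (η x • symPart (G x)) with hX
  set Y := ∫ x, normSq (tensorGrad η v x) with hY
  have hY0 : 0 ≤ Y := integral_nonneg fun x => normSq_nonneg _
  have hkorn : ∫ x, normSq (η x • G x + tensorGrad η v x) ≤ 4 * X + 4 * Y := by
    have h1 : ∫ x, normSq (symPart (η x • G x + tensorGrad η v x)) ≤ 2 * X + 2 * Y := by
      rw [hX, hY, ← integral_const_mul, ← integral_const_mul,
        ← integral_add (hei.const_mul 2) (hTi.const_mul 2)]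
      refine integral_mono (integrable_normSq (memLp_symPart hw1.memLp_grad))
        ((hei.const_mul 2).add (hTi.const_mul 2)) fun x => ?_
      simp only [symPart_add, symPart_smul]
      linarith [normSq_add_le (η x • symPart (G x)) (symPart (tensorGrad η v x)),
        normSq_symPart_le (tensorGrad η v x)]
    linarith [hw1.korn hU]
  have hw2le : ∫ x, normSq (η x ^ 2 • G x + (2 * η x) • tensorGrad η v x) ≤ 8 * X + 10 * Y := by
    have hw1i := integrable_normSq hw1.memLp_grad
    have h1 : ∫ x, normSq (η x ^ 2 • G x + (2 * η x) • tensorGrad η v x) ≤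
        2 * (∫ x, normSq (η x • G x + tensorGrad η v x)) + 2 * Y := by
      rw [hY, ← integral_const_mul, ← integral_const_mul,
        ← integral_add (hw1i.const_mul 2) (hTi.const_mul 2)]
      refine integral_mono (integrable_normSq hw2.memLp_grad)
        ((hw1i.const_mul 2).add (hTi.const_mul 2)) fun x => ?_
      have e : η x ^ 2 • G x + (2 * η x) • tensorGrad η v x =
          η x • ((η x • G x + tensorGrad η v x) + tensorGrad η v x) := by
        ext i j
        simp only [Matrix.add_apply, Matrix.smul_apply, smul_eq_mul]
        ring
      have hsq : η x ^ 2 ≤ 1 := pow_le_one₀ (hη1 x).1 (hη1 x).2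
      simp only [e, normSq_smul]
      exact (mul_le_of_le_one_left (normSq_nonneg _) hsq).trans (normSq_add_le _ _)
    linarith
  have hcoer : 3 / 4 * lam * X ≤
      (∫ x in (Ω : Set (Vec d)), dot ((C x).app (symPart (G x)))
        (symPart (η x ^ 2 • G x + (2 * η x) • tensorGrad η v x))) +
        4 * d ^ 4 * Λ ^ 2 / lam * Y := by
    have hXΩ : X = ∫ x in (Ω : Set (Vec d)), normSq (η x • symPart (G x)) :=
      (setIntegral_eq_integral_of_forall_compl_eq_zero fun x hx => by
        simp [hη0 x hx, normSq]).symm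
    have hYΩ : ∫ x in (Ω : Set (Vec d)), normSq (tensorGrad η v x) ≤ Y :=
      setIntegral_le_integral hTi (.of_forall fun x => normSq_nonneg _)
    have hdi := integrable_dot (memLp_app hC (memLp_symPart hv.memLp_grad))
      (fun i j => (memLp_symPart hw2.memLp_grad i j).restrict (Ω : Set (Vec d)))
    have hb : ∀ᵐ x ∂(volume.restrict (Ω : Set (Vec d))), ∀ i j k l, |C x i j k l| ≤ Λ := by
      simp only [Filter.eventually_all]
      exact hC.bound
    have h1 : 3 / 4 * lam * X ≤
        (∫ x in (Ω : Set (Vec d)), dot ((C x).app (symPart (G x)))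
          (symPart (η x ^ 2 • G x + (2 * η x) • tensorGrad η v x))) +
          4 * d ^ 4 * Λ ^ 2 / lam * ∫ x in (Ω : Set (Vec d)), normSq (tensorGrad η v x) := by
      rw [hXΩ, ← integral_const_mul, ← integral_const_mul,
        ← integral_add hdi (hTi.restrict.const_mul _)]
      refine integral_mono_ae (hei.restrict.const_mul _) (hdi.add (hTi.restrict.const_mul _)) ?_
      filter_upwards [hb, hconv] with x hx1 hx2
      exact coercive_pointwise hd hlam hx1 hx2 (η x) (G x) (tensorGrad η v x)
    refine h1.trans (add_le_add le_rfl (mul_le_mul_of_nonneg_left hYΩ (by positivity)))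
  have hweak := hsol.abs_integral_le hC hv.memLp_grad hU hUΩ hK hw2
  have hI0 : 0 ≤ ∫ x, normSq (η x ^ 2 • G x + (2 * η x) • tensorGrad η v x) :=
    integral_nonneg fun x => normSq_nonneg _
  set I := ∫ x, normSq (η x ^ 2 • G x + (2 * η x) • tensorGrad η v x) with hI
  -- The weight lam/32 turns I ≤ 8X + 10Y into lam/4 · X, which the 3/4 · lam · X on the left
  -- absorbs, leaving lam/2 · X.
  have hyoung : K * Real.sqrt I ≤ 8 / lam * K ^ 2 + lam / 32 * I := by
    have h1 : 8 / lam * K ^ 2 + lam / 32 * I - K * Real.sqrt I =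
        (16 * K - lam * Real.sqrt I) ^ 2 / (32 * lam) := by
      nth_rewrite 1 [← Real.sq_sqrt hI0]
      field_simp
      ring
    have h2 : 0 ≤ (16 * K - lam * Real.sqrt I) ^ 2 / (32 * lam) := by positivity
    linarith
  have hfin : lam / 2 * X ≤ 8 / lam * K ^ 2 + (5 / 16 * lam + 4 * d ^ 4 * Λ ^ 2 / lam) * Y := by
    have h1 := (le_abs_self _).trans hweak
    have h2 : lam / 32 * I ≤ lam / 32 * (8 * X + 10 * Y) :=
      mul_le_mul_of_nonneg_left hw2le (by positivity)
    linarith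
  have hfin' : 4 * X ≤ 64 / lam ^ 2 * K ^ 2 +
      (5 / 2 + 32 * d ^ 4 * Λ ^ 2 / lam ^ 2) * Y := by
    have h1 := mul_le_mul_of_nonneg_left hfin (by positivity : 0 ≤ 8 / lam)
    have e1 : 8 / lam * (lam / 2 * X) = 4 * X := by
      field_simp
      ring
    have e2 : 8 / lam * (8 / lam * K ^ 2 + (5 / 16 * lam + 4 * d ^ 4 * Λ ^ 2 / lam) * Y) =
        64 / lam ^ 2 * K ^ 2 + (5 / 2 + 32 * d ^ 4 * Λ ^ 2 / lam ^ 2) * Y := by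
      field_simp
      ring
    rwa [e1, e2] at h1
  linarith

end Elasticity

/-! ### The Caccioppoli inequality on concentric balls. -/

theorem theoremA1 (d : ℕ) (hd : 2 ≤ d) (lam Λ : ℝ) (hlam : 0 < lam) :
    ∃ C₁ C₂ : ℝ, 0 < C₁ ∧ 0 < C₂ ∧
      ∀ (Ω : Opens (Elasticity.Vec d)), Bornology.IsBounded (Ω : Set (Elasticity.Vec d)) →
      ∀ (C : Elasticity.Vec d → Elasticity.Tensor4 d),
        Elasticity.IsBoundedTensor Ω C Λ → Elasticity.IsStronglyConvex Ω C lam →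
      ∀ (f : 𝓓(Ω, Elasticity.Vec d) →ₗ[ℝ] ℝ), Elasticity.IsHNegOne f →
      ∀ (u : Elasticity.Vec d → Elasticity.Vec d) (G : Elasticity.Vec d → Elasticity.Mat d),
        Elasticity.IsH1 Ω u G → Elasticity.IsWeakSolution Ω C G f →
      ∀ (x₀ : Elasticity.Vec d) (ρ : ℝ), 0 < ρ →
        Metric.ball x₀ (2 * ρ) ⊆ (Ω : Set (Elasticity.Vec d)) →
      ∀ (ubar : Elasticity.Vec d),
        (∫ x in Metric.ball x₀ ρ, Elasticity.normSq (G x)) ≤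
          C₁ / ρ ^ 2 * (∫ x in Metric.ball x₀ (2 * ρ), ‖u x - ubar‖ ^ 2) +
            C₂ * Elasticity.hNegOneNorm f (Metric.ball x₀ (2 * ρ)) ^ 2 := by
  obtain ⟨c, hc, hcut⟩ := Elasticity.exists_cutoff d
  set Q : ℝ := 13 / 2 + 32 * d ^ 4 * Λ ^ 2 / lam ^ 2 with hQ
  have hQ0 : 0 < Q := by positivity
  refine ⟨Q * c, 64 / lam ^ 2, by positivity, by positivity, ?_⟩
  intro Ω hΩ C hC hconv f hf u G hu hsol x₀ ρ hρ hball ubar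
  obtain ⟨η, hη, hηs, hηU, hη01, hη1, hηD⟩ := hcut x₀ ρ hρ
  have hv := hu.sub_const hΩ ubar
  have hest := Elasticity.cutoff_estimate (by omega) hlam hC hconv hv hsol Metric.isOpen_ball hball
    (Elasticity.isHNegOneBound_hNegOneNorm hf hball) hη hηs hηU hη01
  have hw := hv.smul_cutoff hη hηs hηU hball
  have hηΩ := hηU.trans hball
  have hleft : ∫ x in Metric.ball x₀ ρ, Elasticity.normSq (G x) ≤
      ∫ x, Elasticity.normSq (η x • G x + Elasticity.tensorGrad η (fun x => u x - ubar) x) := by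
    have h1 : ∫ x in Metric.ball x₀ ρ, Elasticity.normSq (G x) = ∫ x in Metric.ball x₀ ρ,
        Elasticity.normSq (η x • G x + Elasticity.tensorGrad η (fun x => u x - ubar) x) := by
      refine setIntegral_congr_fun measurableSet_ball fun x hx => ?_
      have hD : fderiv ℝ η x = 0 := by
        have h2 : η =ᶠ[nhds x] fun _ => 1 :=
          Filter.eventuallyEq_of_mem (Metric.isOpen_ball.mem_nhds hx) hη1
        rw [h2.fderiv_eq, fderiv_fun_const]
        rfl
      have hT : Elasticity.tensorGrad η (fun x => u x - ubar) x = 0 := by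
        ext i j
        simp [Elasticity.tensorGrad, hD]
      simp only [hη1 x hx, hT, one_smul, add_zero]
    rw [h1]
    exact setIntegral_le_integral (Elasticity.integrable_normSq hw.memLp_grad)
      (.of_forall fun x => Elasticity.normSq_nonneg _)
  have hright : ∫ x, Elasticity.normSq (Elasticity.tensorGrad η (fun x => u x - ubar) x) ≤
      c / ρ ^ 2 * ∫ x in Metric.ball x₀ (2 * ρ), ‖u x - ubar‖ ^ 2 := by
    have hT := Elasticity.integrable_normSq (hv.memLp_tensorGrad hη hηs hηΩ)
    have h1 : ∫ x, Elasticity.normSq (Elasticity.tensorGrad η (fun x => u x - ubar) x) =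
        ∫ x in Metric.ball x₀ (2 * ρ),
          Elasticity.normSq (Elasticity.tensorGrad η (fun x => u x - ubar) x) := by
      refine (setIntegral_eq_integral_of_forall_compl_eq_zero fun x hx => ?_).symm
      rw [Elasticity.normSq_tensorGrad, fderiv_of_notMem_tsupport ℝ fun h => hx (hηU h)]
      simp
    have hi : IntegrableOn (fun x => ‖u x - ubar‖ ^ 2) (Metric.ball x₀ (2 * ρ)) := by
      refine IntegrableOn.mono_set ?_ hball
      simp only [EuclideanSpace.real_norm_sq_eq]
      exact integrable_finsetSum _ fun i _ => (hv.memLp i).integrable_sq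
    rw [h1, ← integral_const_mul]
    refine setIntegral_mono hT.integrableOn (hi.const_mul _) fun x => ?_
    simp only [Elasticity.normSq_tensorGrad]
    exact mul_le_mul_of_nonneg_right (hηD x) (by positivity)
  have hmul := mul_le_mul_of_nonneg_left hright hQ0.le
  have hassoc : Q * (c / ρ ^ 2 * ∫ x in Metric.ball x₀ (2 * ρ), ‖u x - ubar‖ ^ 2) =
      Q * c / ρ ^ 2 * ∫ x in Metric.ball x₀ (2 * ρ), ‖u x - ubar‖ ^ 2 := by ring
  rw [← hQ] at hest
  exact hleft.trans (hest.trans (add_le_add (hmul.trans hassoc.le) le_rfl))
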